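/- Let $n,m\ge 1$ be integers. A preference profile $\sigma=(\sigma_1,\dots,\sigma_n)$ of $n$ metrics on $m$ alternatives assigns to each metric $i\in N=\{1,\dots,n\}$ a ranking of the alternatives, that is, a bijection $\sigma_i:\{1,\dots,m\}\to\{1,\dots,m\}$, where $\sigma_i(a)$ is the rank of alternative $a$ (rank $1$ is best). For $K\subseteq N$, an alternative $a$ and $r\in\{1,\dots,m\}$, let $C(K,r,a)=|\{i\in K:\sigma_i(a)\le r\}|$. For $\varepsilon\ge 0$, a subset $K\subseteq N$ satisfies $\varepsilon$-positional proportionality if for every alternative $a$ and every $r\in\{1,\dots,m\}$, $$\left|\frac{C(N,r,a)}{|N|}-\frac{C(K,r,a)}{|K|}\right|\le\varepsilon,$$ where the second quotient is read as $0$ if $K=\emptyset$ (with this convention $\emptyset$ never satisfies the property when $\varepsilon<1$). Theorem. Let $0<\varepsilon\le 1/24$. For every sufficiently large $m$ (that is, for all $m\ge M$ with some $M$ depending only on $\varepsilon$) there are $n\ge 1$ and a preference profile $\sigma$ of $n$ metrics on $m$ alternatives such that no $K\subseteq N$ with $$|K|\le\frac{1}{288\,\varepsilon^2}\log m$$ satisfies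 $\varepsilon$-positional proportionality. Here $\log$ is the natural logarithm. -/

import Mathlib

/-- A ranking of `m` alternatives: a bijection sending each alternative to its position.
Positions are `0`-indexed, so `(τ a : ℕ) + 1 ∈ {1, …, m}` is the rank of the alternative `a`. -/
abbrev Ranking (m : ℕ) : Type := Fin m ≃ Fin m

/-- The rank in `{1, …, m}` of the alternative `a`; rank `1` is the best one. -/
def Ranking.rank {m : ℕ} (τ : Ranking m) (a : Fin m) : ℕ := (τ a : ℕ) + 1

/-- A preference profile: each of the `n` metrics has a ranking of the `m` alternatives. -/
abbrev Profile (n m : ℕ) : Type := Fin n → Ranking m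

/-- `C(K, r, a)`: the number of metrics in `K` that rank the alternative `a` in the top `r`. -/
def Profile.topCount {n m : ℕ} (σ : Profile n m) (K : Finset (Fin n)) (r : ℕ) (a : Fin m) : ℕ :=
  (K.filter fun i => Ranking.rank (σ i) a ≤ r).card

/-- `ε`-positional proportionality of the subset `K` of the set `N = Finset.univ` of all metrics.
For `K = ∅` the second quotient is `0 / 0 = 0`; if `n ≥ 1`, `m ≥ 1` and `ε < 1`, the empty set is
then never proportional (take `r = m`), as it should be. -/
def Profile.IsPositionallyProportional {n m : ℕ} (σ : Profile n m) (ε : ℝ)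
    (K : Finset (Fin n)) : Prop :=
  ∀ a : Fin m, ∀ r ∈ Finset.Icc 1 m,
    |(σ.topCount Finset.univ r a : ℝ) / (n : ℝ) - (σ.topCount K r a : ℝ) / (K.card : ℝ)| ≤ ε

open Finset in
/-- If every `b` is related to at least `q · |α|` elements of `α`, and `|β| (1 - q) ^ h < 1`, then
some `h` elements of `α` meet all of `β`. -/
theorem exists_forall_exists_rel_of_card_mul_pow_lt_one {α β : Type*} [Fintype α] [Nonempty α]
    (S : Finset β) (R : α → β → Prop) (q : ℝ) (h : ℕ)
    (hR : ∀ b ∈ S, ∃ T : Finset α, (∀ a ∈ T, R a b) ∧ q * Fintype.card α ≤ (T.card : ℝ))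
    (hS : (S.card : ℝ) * (1 - q) ^ h < 1) :
    ∃ f : Fin h → α, ∀ b ∈ S, ∃ p, R (f p) b := by
  classical
  by_contra! hcon
  choose! T hT hcard using hR
  have hα : (0 : ℝ) < Fintype.card α := by exact_mod_cast Fintype.card_pos
  have hsub : (univ : Finset (Fin h → α)) ⊆
      S.biUnion fun b => Fintype.piFinset fun _ : Fin h => (T b)ᶜ := by
    intro f _
    obtain ⟨b, hb, hf⟩ := hcon f
    refine mem_biUnion.2 ⟨b, hb, Fintype.mem_piFinset.2 fun p => ?_⟩
    exact mem_compl.2 fun hp => hf p (hT b hb _ hp)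
  have hle := (card_le_card hsub).trans card_biUnion_le
  simp only [card_univ, Fintype.card_fun, Fintype.card_fin, Fintype.card_piFinset_const] at hle
  have hle' : (Fintype.card α : ℝ) ^ h ≤ ∑ b ∈ S, (((T b)ᶜ.card : ℕ) : ℝ) ^ h := by
    exact_mod_cast hle
  have hterm : ∀ b ∈ S, (((T b)ᶜ.card : ℕ) : ℝ) ^ h ≤ ((1 - q) * Fintype.card α) ^ h := by
    intro b hb
    refine pow_le_pow_left₀ (by positivity) ?_ h
    rw [card_compl, Nat.cast_sub (card_le_univ _)]
    linarith [hcard b hb]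
  have hsum := hle'.trans (sum_le_sum hterm)
  rw [sum_const, nsmul_eq_mul, mul_pow, ← mul_assoc] at hsum
  have hpos : (0 : ℝ) < (Fintype.card α : ℝ) ^ h := by positivity
  nlinarith

open Finset in
/-- At least half of the subsets of a finite set contain at most half of its elements. -/
theorem two_pow_card_le_two_mul_card_filter_powerset {α : Type*} [DecidableEq α]
    (s : Finset α) :
    2 ^ s.card ≤ 2 * (s.powerset.filter fun w => 2 * w.card ≤ s.card).card := by
  have hsplit := card_filter_add_card_filter_not (s := s.powerset)
    (fun w => 2 * w.card ≤ s.card)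
  rw [card_powerset] at hsplit
  have hle : (s.powerset.filter fun w => ¬ 2 * w.card ≤ s.card).card ≤
      (s.powerset.filter fun w => 2 * w.card ≤ s.card).card := by
    refine card_le_card_of_injOn (fun w => s \ w) ?_ ?_
    · intro w hw
      simp only [coe_filter, mem_powerset, Set.mem_ofPred_eq] at hw ⊢
      refine ⟨sdiff_subset, ?_⟩
      rw [card_sdiff_of_subset hw.1]
      omega
    · intro w hw w' hw' heq
      simp only [coe_filter, mem_powerset, Set.mem_ofPred_eq] at hw hw'
      have := congrArg (fun u => s \ u) heq
      simpa [Finset.sdiff_sdiff_eq_self hw.1, Finset.sdiff_sdiff_eq_self hw'.1] using this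
  omega

open Finset in
/-- Many sets meet `K` in exactly `j` points and contain at most half of the complement of `K`. -/
theorem exists_finset_card_inter_eq_and_card_sdiff_le {n : ℕ} (K : Finset (Fin n)) (j : ℕ) :
    ∃ T : Finset (Finset (Fin n)),
      (∀ v ∈ T, (v ∩ K).card = j ∧ 2 * (v \ K).card ≤ n - K.card) ∧
      K.card.choose j * 2 ^ (n - K.card) ≤ 2 * T.card := by
  classical
  have hc : (Kᶜ).card = n - K.card := by rw [card_compl, Fintype.card_fin]
  set W := (Kᶜ).powerset.filter fun w => 2 * w.card ≤ (Kᶜ).card with hW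
  have key : ∀ x ∈ powersetCard j K ×ˢ W, (x.1 ∪ x.2) ∩ K = x.1 ∧ (x.1 ∪ x.2) \ K = x.2 := by
    rintro ⟨a, w⟩ hx
    simp only [hW, mem_product, mem_powersetCard, mem_filter, mem_powerset] at hx
    obtain ⟨⟨ha, -⟩, hw, -⟩ := hx
    constructor
    · ext i
      have h1 := @ha i
      have h2 := @hw i
      simp only [mem_compl] at h2
      simp only [mem_inter, mem_union]
      tauto
    · ext i
      have h1 := @ha i
      have h2 := @hw i
      simp only [mem_compl] at h2
      simp only [mem_sdiff, mem_union]
      tauto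
  refine ⟨(powersetCard j K ×ˢ W).image fun x => x.1 ∪ x.2, ?_, ?_⟩
  · intro v hv
    obtain ⟨x, hx, rfl⟩ := mem_image.1 hv
    obtain ⟨h1, h2⟩ := key x hx
    rw [h1, h2, ← hc]
    simp only [hW, mem_product, mem_powersetCard, mem_filter] at hx
    exact ⟨hx.1.2, hx.2.2⟩
  · rw [card_image_of_injOn, card_product, card_powersetCard, ← hc]
    · have := two_pow_card_le_two_mul_card_filter_powerset (Kᶜ)
      calc _ ≤ K.card.choose j * (2 * W.card) := Nat.mul_le_mul_left _ this
        _ = _ := by ring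
    · intro x hx y hy hxy
      have hxy' : x.1 ∪ x.2 = y.1 ∪ y.2 := hxy
      obtain ⟨h1, h2⟩ := key x hx
      obtain ⟨h3, h4⟩ := key y hy
      rw [hxy'] at h1 h2
      exact Prod.ext (h1.symm.trans h3) (h2.symm.trans h4)

/-- Consecutive binomial coefficients bounded below by a geometric progression. -/
theorem pow_mul_choose_le_choose_add {k l : ℕ} {ρ : ℝ} (hρ : 0 ≤ ρ) (t : ℕ)
    (hratio : ρ * (l + t : ℝ) ≤ (k : ℝ) - (l + t) + 1) :
    ρ ^ t * (k.choose l : ℝ) ≤ k.choose (l + t) := by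
  induction t with
  | zero => simp
  | succ t ih =>
    push_cast at hratio
    have ih' := ih (by nlinarith)
    have hk : l + t ≤ k := by
      have : (0 : ℝ) ≤ (k : ℝ) - (l + (t + 1)) + 1 := le_trans (by positivity) hratio
      have : ((l + t : ℕ) : ℝ) ≤ k := by push_cast; linarith
      exact_mod_cast this
    have hrec : (k.choose (l + t + 1) : ℝ) * (l + t + 1) =
        (k.choose (l + t) : ℝ) * ((k : ℝ) - (l + t)) := by
      have := Nat.choose_succ_right_eq k (l + t)
      have h2 : ((k.choose (l + t + 1) * (l + t + 1) : ℕ) : ℝ) =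
        ((k.choose (l + t) * (k - (l + t)) : ℕ) : ℝ) := by exact_mod_cast this
      push_cast [Nat.cast_sub hk] at h2
      exact h2
    have hpos : (0 : ℝ) < (l : ℝ) + t + 1 := by positivity
    refine le_of_mul_le_mul_right ?_ hpos
    calc ρ ^ (t + 1) * (k.choose l : ℝ) * (l + t + 1)
        = ρ ^ t * (k.choose l : ℝ) * (ρ * (l + t + 1)) := by ring
      _ ≤ (k.choose (l + t) : ℝ) * ((k : ℝ) - (l + t)) := by
          apply mul_le_mul ih' (by linarith) (by positivity) (by positivity)
      _ = _ := by rw [← hrec]; rfl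

theorem two_pow_le_succ_mul_choose_half (k : ℕ) : 2 ^ k ≤ (k + 1) * k.choose (k / 2) := by
  rw [← Nat.sum_range_choose]
  simpa using Finset.sum_le_card_nsmul (Finset.range (k + 1)) (fun i => k.choose i) _
    fun i _ => Nat.choose_le_middle i k

/-- A lower bound of Gaussian order for the upper tail of the symmetric binomial distribution. -/
theorem exists_const_mul_exp_le_choose (ε : ℝ) (hε : 0 < ε) (hε' : ε ≤ 1 / 24) :
    ∃ c : ℝ, 0 < c ∧ ∀ k : ℕ, ∃ j : ℕ, (1 / 2 + 2 * ε) * k ≤ j ∧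
      c * Real.exp (-(144 * ε ^ 2 * k)) * 2 ^ k ≤ k.choose j := by
  set B : ℕ := ⌈1 / ε⌉₊ with hB
  refine ⟨min (1 / 2 ^ B) (ε ^ 2 * Real.exp (-(28 * ε))), by positivity, fun k => ?_⟩
  by_cases hk : k ≤ B
  · refine ⟨k, by nlinarith [Nat.cast_nonneg (α := ℝ) k], ?_⟩
    rw [Nat.choose_self, Nat.cast_one]
    calc min (1 / 2 ^ B) (ε ^ 2 * Real.exp (-(28 * ε))) * Real.exp (-(144 * ε ^ 2 * k)) * 2 ^ k
        ≤ (1 / 2 ^ B) * 1 * 2 ^ B := by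
          gcongr
          · exact min_le_left _ _
          · exact Real.exp_le_one_iff.2 (by simp only [neg_nonpos]; positivity)
          · norm_num
      _ = 1 := by field_simp
  · have hkε : 1 ≤ ε * k := by
      have h1 : 1 / ε ≤ k := (Nat.le_ceil _).trans (by exact_mod_cast (not_le.1 hk).le)
      rwa [div_le_iff₀' hε] at h1
    have hk0 : (0 : ℝ) ≤ k := Nat.cast_nonneg k
    set j : ℕ := ⌈(1 / 2 + 2 * ε) * (k : ℝ)⌉₊ with hj
    have hj1 : (1 / 2 + 2 * ε) * (k : ℝ) ≤ j := Nat.le_ceil _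
    have hj2 : (j : ℝ) < (1 / 2 + 2 * ε) * (k : ℝ) + 1 := Nat.ceil_lt_add_one (by positivity)
    refine ⟨j, hj1, ?_⟩
    have hl1 : ((k / 2 : ℕ) : ℝ) ≤ k / 2 := Nat.cast_div_le
    have hl2 : (k : ℝ) ≤ 2 * ((k / 2 : ℕ) : ℝ) + 1 := by
      exact_mod_cast (by omega : k ≤ 2 * (k / 2) + 1)
    have hlj : k / 2 ≤ j := by
      have : ((k / 2 : ℕ) : ℝ) ≤ j := by nlinarith
      exact_mod_cast this
    obtain ⟨t, ht⟩ := Nat.exists_eq_add_of_le hlj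
    have htR : (j : ℝ) = ((k / 2 : ℕ) : ℝ) + t := by exact_mod_cast ht
    have ht2 : (t : ℝ) ≤ 2 * ε * k + 2 := by nlinarith
    have hρ : Real.exp (-(14 * ε)) * (1 / 2 + 3 * ε) ≤ 1 / 2 - 2 * ε := by
      have h1 : 1 + 14 * ε ≤ Real.exp (14 * ε) := by linarith [Real.add_one_le_exp (14 * ε)]
      rw [Real.exp_neg, inv_mul_le_iff₀ (Real.exp_pos _)]
      have : (1 / 2 + 3 * ε) ≤ (1 + 14 * ε) * (1 / 2 - 2 * ε) := by nlinarith
      exact this.trans (mul_le_mul_of_nonneg_right h1 (by linarith))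
    have hchoose := pow_mul_choose_le_choose_add (k := k) (l := k / 2)
      (Real.exp_pos (-(14 * ε))).le t (by
        rw [← htR]
        calc Real.exp (-(14 * ε)) * (j : ℝ) ≤ Real.exp (-(14 * ε)) * ((1 / 2 + 3 * ε) * k) := by
              gcongr; nlinarith
          _ ≤ (1 / 2 - 2 * ε) * k := by
              rw [← mul_assoc]; exact mul_le_mul_of_nonneg_right hρ hk0
          _ ≤ _ := by linarith)
    rw [← ht] at hchoose
    refine le_trans ?_ hchoose
    have hmid : (2 : ℝ) ^ k ≤ (k + 1) * k.choose (k / 2) := by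
      exact_mod_cast two_pow_le_succ_mul_choose_half k
    have hexp : ε ^ 2 * ((k : ℝ) + 1) ≤ Real.exp (ε ^ 2 * k) := by
      have := Real.add_one_le_exp (ε ^ 2 * k)
      nlinarith
    have hpow : Real.exp (-(28 * ε ^ 2 * k + 28 * ε)) ≤ Real.exp (-(14 * ε)) ^ t := by
      rw [← Real.exp_nat_mul]
      apply Real.exp_le_exp.2
      nlinarith
    have hsplit : Real.exp (-(28 * ε)) * Real.exp (-(144 * ε ^ 2 * k)) * Real.exp (ε ^ 2 * k) ≤
        Real.exp (-(28 * ε ^ 2 * k + 28 * ε)) := by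
      rw [← Real.exp_add, ← Real.exp_add]
      apply Real.exp_le_exp.2
      have : 0 ≤ ε ^ 2 * k := by positivity
      linarith
    calc min (1 / 2 ^ B) (ε ^ 2 * Real.exp (-(28 * ε))) * Real.exp (-(144 * ε ^ 2 * k)) * 2 ^ k
        ≤ ε ^ 2 * Real.exp (-(28 * ε)) * Real.exp (-(144 * ε ^ 2 * k)) *
            ((k + 1) * k.choose (k / 2)) := by
          gcongr
          exact min_le_right _ _
      _ = Real.exp (-(28 * ε)) * Real.exp (-(144 * ε ^ 2 * k)) * (ε ^ 2 * (k + 1)) *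
            k.choose (k / 2) := by ring
      _ ≤ Real.exp (-(28 * ε)) * Real.exp (-(144 * ε ^ 2 * k)) * Real.exp (ε ^ 2 * k) *
            k.choose (k / 2) := by gcongr
      _ ≤ Real.exp (-(14 * ε)) ^ t * k.choose (k / 2) := by
          gcongr
          exact hsplit.trans hpow

/-- The map that exchanges the alternatives `p` and `p + h`, for every `p < h` outside `s`. -/
def swapFun {m : ℕ} (h : ℕ) (hm : 2 * h ≤ m) (s : Finset (Fin h)) (a : Fin m) : Fin m :=
  if h₁ : (a : ℕ) < h then
    if (⟨a, h₁⟩ : Fin h) ∈ s then a else ⟨a + h, by omega⟩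
  else if h₂ : (a : ℕ) < 2 * h then
    if (⟨a - h, by omega⟩ : Fin h) ∈ s then a else ⟨a - h, by omega⟩
  else a

theorem swapFun_involutive {m : ℕ} (h : ℕ) (hm : 2 * h ≤ m) (s : Finset (Fin h)) :
    Function.Involutive (swapFun h hm s) := by
  intro a
  unfold swapFun
  by_cases h₁ : (a : ℕ) < h
  · by_cases hs : (⟨a, h₁⟩ : Fin h) ∈ s
    · simp [h₁, hs]
    · have h₂ : (a : ℕ) + h < 2 * h := by omega
      simp [h₁, hs, h₂]
  · by_cases h₂ : (a : ℕ) < 2 * h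
    · by_cases hs : (⟨a - h, by omega⟩ : Fin h) ∈ s
      · simp [h₁, h₂, hs]
      · have h₃ : (a : ℕ) - h < h := by omega
        have h₄ : (a : ℕ) - h + h = a := by omega
        simp [h₁, h₂, hs, h₃, h₄]
    · simp [h₁, h₂]

/-- The identity ranking with the alternatives `p` and `p + h` exchanged for every `p < h`
outside `s`. -/
def swapRanking {m : ℕ} (h : ℕ) (hm : 2 * h ≤ m) (s : Finset (Fin h)) : Ranking m :=
  (swapFun_involutive h hm s).toPerm

theorem rank_swapRanking_le_iff {m : ℕ} (h : ℕ) (hm : 2 * h ≤ m) (s : Finset (Fin h))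
    (p : Fin h) : (swapRanking h hm s).rank ⟨p, by omega⟩ ≤ h ↔ p ∈ s := by
  change (swapFun h hm s ⟨p, by omega⟩ : ℕ) + 1 ≤ h ↔ p ∈ s
  unfold swapFun
  by_cases hp : p ∈ s
  · simp [hp]
  · simp [hp]

/-- The profile in which the metric `i` ranks the alternative `p < h` in the top `h` iff
`i ∈ v p`. -/
def swapProfile {n m : ℕ} (h : ℕ) (hm : 2 * h ≤ m) (v : Fin h → Finset (Fin n)) : Profile n m :=
  fun i => swapRanking h hm (Finset.univ.filter fun p => i ∈ v p)

theorem topCount_swapProfile {n m : ℕ} (h : ℕ) (hm : 2 * h ≤ m) (v : Fin h → Finset (Fin n))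
    (K : Finset (Fin n)) (p : Fin h) :
    (swapProfile h hm v).topCount K h ⟨p, by omega⟩ = (v p ∩ K).card := by
  unfold Profile.topCount swapProfile
  congr 1
  ext i
  simp only [Finset.mem_filter, rank_swapRanking_le_iff, Finset.mem_inter, Finset.mem_univ,
    true_and]
  exact and_comm

theorem not_isPositionallyProportional_empty {n m : ℕ} (hn : 0 < n) (hm : 0 < m) {ε : ℝ}
    (hε : ε < 1) (σ : Profile n m) : ¬ σ.IsPositionallyProportional ε ∅ := by
  intro hK
  have h1 := hK ⟨0, hm⟩ m (Finset.mem_Icc.2 ⟨hm, le_rfl⟩)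
  have h2 : σ.topCount Finset.univ m ⟨0, hm⟩ = n := by
    unfold Profile.topCount Ranking.rank
    rw [Finset.filter_true_of_mem fun i _ => Nat.succ_le_of_lt (σ i ⟨0, hm⟩).isLt, Finset.card_univ, Fintype.card_fin]
  have h3 : (n : ℝ) ≠ 0 := by exact_mod_cast hn.ne'
  rw [h2, div_self h3] at h1
  simp only [Finset.card_empty, Nat.cast_zero, div_zero, sub_zero, abs_one] at h1
  linarith

/-- A set that contains at least `(1/2 + 2ε)|K|` points of `K`, and at most half of the points
outside `K`, has density on `K` exceeding its overall density by more than `ε`. -/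
theorem lt_density_sub_of_card_inter {n : ℕ} {ε : ℝ} {K v : Finset (Fin n)}
    (hK : 0 < K.card) (hKn : (K.card : ℝ) ≤ ε * n)
    (h₁ : (1 / 2 + 2 * ε) * K.card ≤ ((v ∩ K).card : ℝ)) (h₂ : 2 * (v \ K).card ≤ n - K.card) :
    ε < ((v ∩ K).card : ℝ) / K.card - (v.card : ℝ) / n := by
  have hKn' : K.card ≤ n := by simpa using Finset.card_le_univ K
  have hn : (0 : ℝ) < n := by exact_mod_cast hK.trans_le hKn'
  have hK' : (0 : ℝ) < K.card := by exact_mod_cast hK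
  have hA : 1 / 2 + 2 * ε ≤ ((v ∩ K).card : ℝ) / K.card := by rwa [le_div_iff₀ hK']
  have hv : (v.card : ℝ) = (v ∩ K).card + (v \ K).card := by
    exact_mod_cast (Finset.card_inter_add_card_sdiff v K).symm
  have hi : ((v ∩ K).card : ℝ) ≤ K.card := by
    exact_mod_cast Finset.card_le_card Finset.inter_subset_right
  have hd : 2 * ((v \ K).card : ℝ) ≤ n - K.card := by
    rw [← Nat.cast_sub hKn']
    exact_mod_cast h₂
  have hB : (v.card : ℝ) / n < 1 / 2 + ε := by
    rw [div_lt_iff₀ hn]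
    nlinarith
  linarith

/-- Logarithmic growth is eventually below any constant multiple of `√m`. -/
theorem eventually_mul_log_add_two_lt (b c : ℝ) (hc : 0 < c) :
    ∀ᶠ m : ℕ in Filter.atTop, b * Real.log m + 2 < c * Real.exp (Real.log m / 2) := by
  have h1 : Filter.Tendsto (fun m : ℕ => Real.log m / 2) Filter.atTop Filter.atTop :=
    (Real.tendsto_log_atTop.comp tendsto_natCast_atTop_atTop).atTop_div_const (by norm_num)
  have h2 : ∀ᶠ x : ℝ in Filter.atTop, 2 * b * x + 2 < c * Real.exp x := by
    have ht : Filter.Tendsto (fun x : ℝ => (2 * b * x + 2) / Real.exp x) Filter.atTop (nhds 0) := by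
      have := ((Real.tendsto_pow_mul_exp_neg_atTop_nhds_zero 1).const_mul (2 * b)).add
        ((Real.tendsto_pow_mul_exp_neg_atTop_nhds_zero 0).const_mul 2)
      simp only [mul_zero, add_zero, pow_one, pow_zero, one_mul] at this
      refine this.congr fun x => ?_
      rw [Real.exp_neg]
      ring
    filter_upwards [ht.eventually_lt_const hc] with x hx
    rwa [div_lt_iff₀ (Real.exp_pos x)] at hx
  filter_upwards [h1.eventually h2] with m hm
  linarith

theorem mainTheorem4 (ε : ℝ) (hε : 0 < ε) (hε' : ε ≤ 1 / 24) :
    ∃ M : ℕ, ∀ m : ℕ, M ≤ m →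
      ∃ n : ℕ, 0 < n ∧ ∃ σ : Profile n m,
        ∀ K : Finset (Fin n),
          (K.card : ℝ) ≤ 1 / (288 * ε ^ 2) * Real.log (m : ℝ) →
            ¬ σ.IsPositionallyProportional ε K := by
  obtain ⟨c, hc, htail⟩ := exists_const_mul_exp_le_choose ε hε hε'
  obtain ⟨M, hM⟩ := Filter.eventually_atTop.1
    (eventually_mul_log_add_two_lt (1 / (288 * ε ^ 2) / ε) (c / 8) (by positivity))
  refine ⟨max M 2, fun m hm => ?_⟩
  have hm2 : 2 ≤ m := (le_max_right _ _).trans hm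
  have hlarge := hM m ((le_max_left _ _).trans hm)
  set L : ℝ := 1 / (288 * ε ^ 2) * Real.log m with hL
  have hm0 : (0 : ℝ) < m := by exact_mod_cast (by omega : 0 < m)
  have hlog : 0 ≤ Real.log m := Real.log_natCast_nonneg m
  have hL0 : 0 ≤ L := by positivity
  have hLε : 144 * ε ^ 2 * L = Real.log m / 2 := by rw [hL]; field_simp; ring
  set n : ℕ := ⌈L / ε⌉₊ + 1 with hn
  have hn1 : L ≤ ε * n := by
    have : L / ε ≤ n := by rw [hn]; push_cast; linarith [Nat.le_ceil (L / ε)]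
    rwa [div_le_iff₀' hε] at this
  have hn2 : (n : ℝ) < c / 8 * Real.exp (Real.log m / 2) := by
    have h1 : (⌈L / ε⌉₊ : ℝ) < L / ε + 1 := Nat.ceil_lt_add_one (by positivity)
    have h2 : L / ε = 1 / (288 * ε ^ 2) / ε * Real.log m := by rw [hL]; ring
    rw [hn]; push_cast; linarith
  set h : ℕ := m / 2 with hh
  have hhm : 2 * h ≤ m := by omega
  have hh4 : (m : ℝ) ≤ 4 * h := by exact_mod_cast (by omega : m ≤ 4 * h)
  set q : ℝ := c / 2 * Real.exp (-(Real.log m / 2)) with hq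
  set S : Finset (Finset (Fin n)) :=
    Finset.univ.filter fun K => 0 < K.card ∧ (K.card : ℝ) ≤ L with hS
  have hqh : (n : ℝ) < q * h := by
    have h1 : Real.exp (-(Real.log m / 2)) * m = Real.exp (Real.log m / 2) := by
      conv_lhs => rw [← Real.exp_log hm0, Real.log_exp]
      rw [← Real.exp_add]
      congr 1
      ring
    have h2 : q * m ≤ q * (4 * h) := by gcongr
    have h3 : q * m = c / 2 * Real.exp (Real.log m / 2) := by rw [hq, mul_assoc, h1]
    linarith
  have hR : ∀ K ∈ S, ∃ T : Finset (Finset (Fin n)),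
      (∀ v ∈ T, ε < ((v ∩ K).card : ℝ) / K.card - (v.card : ℝ) / n) ∧
      q * Fintype.card (Finset (Fin n)) ≤ (T.card : ℝ) := by
    intro K hK
    obtain ⟨hK0, hKL⟩ := (Finset.mem_filter.1 hK).2
    obtain ⟨j, hj, hcj⟩ := htail K.card
    obtain ⟨T, hT, hTc⟩ := exists_finset_card_inter_eq_and_card_sdiff_le K j
    refine ⟨T, fun v hv => ?_, ?_⟩
    · obtain ⟨h1, h2⟩ := hT v hv
      exact lt_density_sub_of_card_inter hK0 (hKL.trans hn1) (by rwa [h1]) h2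
    · have hKn : K.card ≤ n := by simpa using Finset.card_le_univ K
      have hTc' : (K.card.choose j : ℝ) * 2 ^ (n - K.card) ≤ 2 * T.card := by exact_mod_cast hTc
      have hexp : Real.exp (-(Real.log m / 2)) ≤ Real.exp (-(144 * ε ^ 2 * K.card)) := by
        apply Real.exp_le_exp.2
        rw [← hLε]
        gcongr
      have hcard : (Fintype.card (Finset (Fin n)) : ℝ) = 2 ^ K.card * 2 ^ (n - K.card) := by
        rw [← pow_add, Nat.add_sub_cancel' hKn]
        simp
      have : c * Real.exp (-(Real.log m / 2)) * 2 ^ K.card * 2 ^ (n - K.card) ≤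
          (K.card.choose j : ℝ) * 2 ^ (n - K.card) := by
        gcongr
        refine le_trans ?_ hcj
        gcongr
      rw [hcard, hq]
      linarith
  have hcount : (S.card : ℝ) * (1 - q) ^ h < 1 := by
    have hS2 : (S.card : ℝ) ≤ 2 ^ n := by
      have : S.card ≤ 2 ^ n := by simpa using Finset.card_le_univ S
      exact_mod_cast this
    by_cases hSe : S = ∅
    · simp [hSe]
    obtain ⟨K, hK⟩ := Finset.nonempty_iff_ne_empty.2 hSe
    have hq1 : q ≤ 1 := by
      obtain ⟨T, -, hT⟩ := hR K hK
      have h1 : (T.card : ℝ) ≤ Fintype.card (Finset (Fin n)) := by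
        exact_mod_cast Finset.card_le_univ T
      have h2 : (0 : ℝ) < Fintype.card (Finset (Fin n)) := by exact_mod_cast Fintype.card_pos
      nlinarith
    have h2e : (2 : ℝ) ≤ Real.exp 1 := by linarith [Real.add_one_le_exp (1 : ℝ)]
    calc (S.card : ℝ) * (1 - q) ^ h ≤ Real.exp 1 ^ n * Real.exp (-q) ^ h := by
          refine mul_le_mul (hS2.trans (pow_le_pow_left₀ (by norm_num) h2e n))
            (pow_le_pow_left₀ (by linarith) ?_ h) (pow_nonneg (by linarith) h) (by positivity)
          linarith [Real.add_one_le_exp (-q)]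
      _ = Real.exp (n - q * h) := by
          rw [← Real.exp_nat_mul, ← Real.exp_nat_mul, ← Real.exp_add]
          congr 1
          ring
      _ < 1 := Real.exp_lt_one_iff.2 (by linarith)
  obtain ⟨v, hv⟩ := exists_forall_exists_rel_of_card_mul_pow_lt_one S
    (fun (v : Finset (Fin n)) K => ε < ((v ∩ K).card : ℝ) / K.card - (v.card : ℝ) / n)
    q h hR hcount
  refine ⟨n, by omega, swapProfile h hhm v, fun K hK hprop => ?_⟩
  rcases K.eq_empty_or_nonempty with rfl | hKne
  · exact not_isPositionallyProportional_empty (by omega) (by omega) (by linarith) _ hprop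
  · obtain ⟨p, hp⟩ := hv K (Finset.mem_filter.2 ⟨Finset.mem_univ _, hKne.card_pos, hK⟩)
    have h1 := hprop ⟨p, by omega⟩ h (Finset.mem_Icc.2 ⟨by omega, by omega⟩)
    rw [topCount_swapProfile, topCount_swapProfile, Finset.inter_univ] at h1
    linarith [(abs_le.1 h1).1]
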